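/- **Setting.** There are $m$ indivisible items and $n$ agents. Agent $i$ has a valuation $v_i:2^{[m]}\to\mathbb R_{\ge 0}$ that is normalized ($v_i(\emptyset)=0$), monotone, multi-unit ($v_i(S)$ depends only on $|S|$) and submodular ($v_i(S)+v_i(T)\ge v_i(S\cap T)+v_i(S\cup T)$). Misreports range over the same class. For valuations $w_i$ on a finite item set $J$, a set $P$ of agents and $S\subseteq J$, let $SW(P,S)$ be the maximum of $\sum_{i\in P}w_i(A_i)$ over all families of pairwise disjoint sets $A_i\subseteq S$. **Mechanism (VCG with copies, parameter $r$).** Draw $\ell$ uniformly from $\{0,\dots,r\}$. Let $J=[m]\times[2^\ell]$ ($2^\ell$ copies of each item), let $g(S)\subseteq[m]$ be the set of items of which $S\subseteq J$ contains a copy, and let $v_i'(S)=v_i(g(S))$. Select an allocation $A'$ of $J$ that * maximizes $\sum_i v_i'(A'_i)$; * is non-redundant: $v'_i(A'_i\setminus\{x\})<v'_i(A'_i)$ for all $i$ and all $x\in A'_i$; * is sequential: with $J$ ordered as $(1,1),\dots,(m,1),(1,2),\dots,(m,2),\dots,(1,2^\ell),\dots,(m,2^\ell)$, the sets $A'_1,\dots,A'_n$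 and the set of unallocated copies are consecutive (possibly empty) intervals, in this order. The selection is an arbitrary function of $\ell$ and of the reported profile. The VCG payments for the instance with copies are $p'_i=SW([n]\setminus\{i\},J)-SW([n]\setminus\{i\},J\setminus A'_i)$, with respect to the valuations $v'$. Then round (interval-based rounding, $q=1/2$): choose $t\in[2^\ell]$ uniformly at random and, with probability $1/2$ each, serve either exactly the agents of $S_t=\{i:\emptyset\ne A'_i\subseteq[m]\times\{t\}\}$ or exactly the agents of $S'_t=\{i: A'_i \text{ contains both a } t\text{-th copy and a } (t+1)\text{-th copy}\}$. A served agent $i$ receives $A_i=g(A'_i)$ and pays $p_i=p'_i$; all other agents receive $A_i=\emptyset$ and pay $p_i=0$. **Theorem.** For all $n,m$ a selection rule with the three properties exists for all profiles and all $\ell$. For every such rule, the mechanism with $r=\lceil 2\log_2 n\rceil$ (and $r=0$ if $n=0$) has the following properties on all profiles of submodular multi-unit valuations. 1. Every realized outcome is feasible: the sets $A_i\subseteq[m]$ are pairwise disjoint and the payments $p_i$ are non-negative. 2. It is truthful in expectation: for every profile $v$, every agent $i$ and every misreport $\tilde v_i$, the expectation of $v_i(A_i)-p_i$ under the report $v_i$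 is at least its expectation under the report $\tilde v_i$, the other reports being $v_{-i}$ in both cases. 3. It is ex-post individually rational: $v_i(A_i)-p_i\ge 0$ for every agent $i$ in every outcome of positive probability. 4. Its expected residual surplus is an $O(\log n)$-approximation to the optimal social welfare: there is a universal constant $C$ (independent of $n$, $m$, the valuations and the selection rule) such that for all $n\ge 2$ one has $C\log_2 n\ge 1$ and $$\mathbb E\Big[\sum_{i}\big(v_i(A_i)-p_i\big)\Big]\ \ge\ \frac{SW([n],[m])}{C\log_2 n}.$$ -/

import Mathlib

namespace ConsumerSurplus

noncomputable section

/-! ### Valuations, allocations, social welfare -/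

/-- A normalized monotone valuation `2^I → ℝ≥0`. -/
structure Valuation (I : Type) where
  val : Finset I → ℝ
  nonneg : ∀ S, 0 ≤ val S
  mono : ∀ S T, S ⊆ T → val S ≤ val T
  empty : val ∅ = 0

/-- `v(S) + v(T) ≥ v(S ∩ T) + v(S ∪ T)`. -/
def Valuation.IsSubmodular {I : Type} [DecidableEq I] (v : Valuation I) : Prop :=
  ∀ S T : Finset I, v.val (S ∩ T) + v.val (S ∪ T) ≤ v.val S + v.val T

/-- The value of a set depends only on its size. -/
def Valuation.IsMultiUnit {I : Type} (v : Valuation I) : Prop :=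
  ∀ S T : Finset I, S.card = T.card → v.val S = v.val T

/-- The submodular multi-unit valuations on `m` items. -/
abbrev MUSValuation (m : ℕ) : Type :=
  {v : Valuation (Fin m) // v.IsMultiUnit ∧ v.IsSubmodular}

/-- `A` allocates (some of) the items of `S` to the agents, each item at most once. -/
def IsAllocation {N J : Type} (S : Finset J) (A : N → Finset J) : Prop :=
  (∀ i, A i ⊆ S) ∧ ∀ i i', i ≠ i' → Disjoint (A i) (A i')

/-- `SW(P, S)`: the largest total value, for the agents of `P`, of an allocation of `S`. -/
def socialWelfare {N J : Type} (w : N → Finset J → ℝ) (P : Finset N) (S : Finset J) : ℝ :=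
  sSup {x | ∃ A : N → Finset J, IsAllocation S A ∧ x = ∑ i ∈ P, w i (A i)}

/-- The supremum in `socialWelfare` is a maximum. -/
theorem socialWelfare_isGreatest {N J : Type} [Finite N] [Finite J]
    (w : N → Finset J → ℝ) (P : Finset N) (S : Finset J) :
    IsGreatest {x | ∃ A : N → Finset J, IsAllocation S A ∧ x = ∑ i ∈ P, w i (A i)}
      (socialWelfare w P S) := by
  have hfin : {x | ∃ A : N → Finset J, IsAllocation S A ∧ x = ∑ i ∈ P, w i (A i)}.Finite := by
    refine (Set.finite_range fun A : N → Finset J => ∑ i ∈ P, w i (A i)).subset ?_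
    rintro x ⟨A, -, rfl⟩
    exact ⟨A, rfl⟩
  have hne : {x | ∃ A : N → Finset J, IsAllocation S A ∧ x = ∑ i ∈ P, w i (A i)}.Nonempty :=
    ⟨_, fun _ => ∅, ⟨fun _ => Finset.empty_subset _, fun _ _ _ => Finset.disjoint_empty_left _⟩,
      rfl⟩
  exact ⟨hne.csSup_mem hfin, fun x hx => le_csSup hfin.bddAbove hx⟩

/-! ### The VCG mechanism -/

/-- `A` allocates all items `J` among all agents `N` with maximal social welfare. -/
def IsWelfareMaximizing {N J : Type} [Fintype N] [Fintype J]
    (w : N → Finset J → ℝ) (A : N → Finset J) : Prop :=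
  IsAllocation Finset.univ A ∧
    ∑ i, w i (A i) = socialWelfare w Finset.univ Finset.univ

/-- The VCG payment `p_i = SW(N \ {i}, J) - SW(N \ {i}, J \ A_i)`. -/
def vcgPayment {N J : Type} [Fintype N] [DecidableEq N] [Fintype J] [DecidableEq J]
    (w : N → Finset J → ℝ) (A : N → Finset J) (i : N) : ℝ :=
  socialWelfare w (Finset.univ.erase i) Finset.univ -
    socialWelfare w (Finset.univ.erase i) (Finset.univ \ A i)

/-- Every allocated item contributes strictly to the value of its owner. -/
def IsNonRedundant {N J : Type} [DecidableEq J]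
    (w : N → Finset J → ℝ) (A : N → Finset J) : Prop :=
  ∀ i, ∀ j ∈ A i, w i (A i \ {j}) < w i (A i)

/-! ### The instance with copies -/

/-- `k` copies of each of `m` items; `(j, t)` is the `t`-th copy of item `j`. -/
abbrev Copies (m k : ℕ) : Type := Fin m × Fin k

/-- `g(S)`: the original items of which `S` contains a copy. -/
def project {m k : ℕ} (S : Finset (Copies m k)) : Finset (Fin m) := S.image Prod.fst

/-- `v_i'(S) = v_i(g(S))`. -/
def copyVal {n m : ℕ} (k : ℕ) (v : Fin n → MUSValuation m) (i : Fin n)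
    (S : Finset (Copies m k)) : ℝ :=
  (v i).1.val (project S)

/-- The place (from `0`) of a copy in the order
`(1,1), …, (m,1), (1,2), …, (m,2), …, (1,k), …, (m,k)`. -/
def position {m k : ℕ} (x : Copies m k) : ℕ := x.2.val * m + x.1.val

/-- The copies, in the order of `position`, are cut into consecutive (possibly empty) intervals
`I_1, …, I_n, I_⊥`, and agent `i` gets `I_i`. -/
def IsSequential {n m k : ℕ} (A : Fin n → Finset (Copies m k)) : Prop :=
  ∃ c : Fin (n + 1) → ℕ, c 0 = 0 ∧ Monotone c ∧
    ∀ i x, x ∈ A i ↔ c i.castSucc ≤ position x ∧ position x < c i.succ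

/-- A rule that selects an allocation of the instance with `2^ℓ` copies of each item, for every
`ℓ` and every reported profile. -/
abbrev AllocationRule (n m : ℕ) : Type :=
  (ℓ : ℕ) → (Fin n → MUSValuation m) → Fin n → Finset (Copies m (2 ^ ℓ))

/-- The admissible implementations of the VCG step: the selected allocation maximizes the social
welfare of the instance with copies, is non-redundant, and is made of consecutive intervals. -/
def IsVCGImplementation {n m : ℕ} (alloc : AllocationRule n m) : Prop :=
  ∀ ℓ v, IsWelfareMaximizing (copyVal (2 ^ ℓ) v) (alloc ℓ v) ∧
    IsNonRedundant (copyVal (2 ^ ℓ) v) (alloc ℓ v) ∧ IsSequential (alloc ℓ v)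

/-! ### Randomized mechanisms -/

/-- The sets given to the agents, and their payments. -/
structure Outcome (n m : ℕ) where
  alloc : Fin n → Finset (Fin m)
  pay : Fin n → ℝ

/-- A randomized direct mechanism for submodular multi-unit valuations. -/
abbrev Mechanism (n m : ℕ) : Type := (Fin n → MUSValuation m) → PMF (Outcome n m)

/-- The expectation of `f` under a finitely supported distribution `μ`. -/
def expect {α : Type} (μ : PMF α) (f : α → ℝ) : ℝ := ∑' o, (μ o).toReal * f o

/-- The utility `v_i(A_i) - p_i` of an agent `i` with valuation `u`. -/
def utility {n m : ℕ} (u : MUSValuation m) (i : Fin n) (o : Outcome n m) : ℝ :=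
  u.1.val (o.alloc i) - o.pay i

/-- All realized outcomes are allocations of the items, with non-negative payments. -/
def Mechanism.IsFeasible {n m : ℕ} (M : Mechanism n m) : Prop :=
  ∀ v, ∀ o ∈ (M v).support, IsAllocation Finset.univ o.alloc ∧ ∀ i, 0 ≤ o.pay i

/-- Truthfulness in expectation. -/
def Mechanism.IsTIE {n m : ℕ} (M : Mechanism n m) : Prop :=
  ∀ (v : Fin n → MUSValuation m) (i : Fin n) (u : MUSValuation m),
    expect (M (Function.update v i u)) (utility (v i) i) ≤ expect (M v) (utility (v i) i)

/-- Ex-post individual rationality. -/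
def Mechanism.IsEPIR {n m : ℕ} (M : Mechanism n m) : Prop :=
  ∀ v, ∀ o ∈ (M v).support, ∀ i, 0 ≤ utility (v i) i o

/-- The expected residual surplus is an `a`-approximation (`a ≥ 1`) of the optimal welfare. -/
def Mechanism.GuaranteesApproximation {n m : ℕ} (M : Mechanism n m) (a : ℝ) : Prop :=
  1 ≤ a ∧ ∀ v : Fin n → MUSValuation m,
    socialWelfare (fun i => (v i).1.val) Finset.univ Finset.univ / a ≤
      expect (M v) (fun o => ∑ i, utility (v i) i o)

/-! ### VCG with copies -/

/-- Serve exactly the agents of `T`: agent `i ∈ T` gets `g(A_i)` and pays `p_i`, the others get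
and pay nothing. -/
def serve {n m k : ℕ} (A : Fin n → Finset (Copies m k)) (p : Fin n → ℝ) (T : Finset (Fin n)) :
    Outcome n m where
  alloc i := if i ∈ T then project (A i) else ∅
  pay i := if i ∈ T then p i else 0

/-- `S_t`: the agents that received at least one copy, and only `t`-th copies. -/
def withinCopy {n m k : ℕ} (A : Fin n → Finset (Copies m k)) (t : Fin k) : Finset (Fin n) :=
  Finset.univ.filter fun i => (A i).Nonempty ∧ ∀ x ∈ A i, x.2 = t

/-- `S'_t`: the agents that received both a `t`-th and a `(t+1)`-th copy. -/
def acrossCopies {n m k : ℕ} (A : Fin n → Finset (Copies m k)) (t : Fin k) : Finset (Fin n) :=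
  Finset.univ.filter fun i => (∃ x ∈ A i, x.2 = t) ∧ ∃ x ∈ A i, x.2.val = t.val + 1

/-- A rounding subroutine: turns an allocation and payments of the instance with `2^ℓ` copies into
a random outcome of the original instance. -/
abbrev Subroutine (n m : ℕ) : Type :=
  (ℓ : ℕ) → (Fin n → Finset (Copies m (2 ^ ℓ))) → (Fin n → ℝ) → PMF (Outcome n m)

/-- The rounding subroutine for multi-unit valuations (`q = 1/2`): choose `t` uniformly among the
`2^ℓ` copies and toss a fair coin; serve either exactly `S_t` or exactly `S'_t`. -/
def intervalRounding (n m : ℕ) : Subroutine n m := fun ℓ A p =>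
  (PMF.uniformOfFintype (Fin (2 ^ ℓ))).bind fun t =>
    (PMF.uniformOfFintype Bool).map fun b =>
      serve A p (if b then withinCopy A t else acrossCopies A t)

/-- VCG with copies: draw `ℓ` uniformly from `{0, …, r}`, run VCG on the instance with `2^ℓ` copies
of each item, and apply the subroutine `B`. -/
def vcgWithCopies {n m : ℕ} (r : ℕ) (alloc : AllocationRule n m) (B : Subroutine n m) :
    Mechanism n m := fun v =>
  (PMF.uniformOfFintype (Fin (r + 1))).bind fun ℓ =>
    B ℓ (alloc ℓ v) (vcgPayment (copyVal (2 ^ (ℓ : ℕ)) v) (alloc ℓ v))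

/-- `r = 2 log₂ n`, rounded up to a natural number. -/
def logParam (n : ℕ) : ℕ := ⌈2 * Real.logb 2 n⌉₊

end

end ConsumerSurplus

namespace ConsumerSurplus

/-! ### Multi-unit valuations as concave functions of a quantity -/

/-! A non-redundant interval holds at most one copy of each item, so it meets at most two
consecutive layers of copies. Hence each agent with a nonempty bundle is served for exactly one of
the `2 * 2 ^ ℓ` choices of layer and coin (`sum_serve_eq`), and given `ℓ` an expected utility is
`2⁻¹ * (2 ^ ℓ)⁻¹` times the VCG utility with copies. Truthfulness is inherited from VCG; feasibility
holds because a served group lies in a single layer or is a single agent.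

For the surplus, let `W_k` be the optimal welfare with `k` copies. Submodular multi-unit valuations
are concave in the quantity, so the optimum with `2k` copies has a market-clearing price
(`exists_price`). With `U` the total utility at this price `p`, `W_2k = 2kmp + U` and `W_k ≤ kmp +
U`, while VCG leaves the agents at least `U`. So the VCG surplus is at least `2 W_k - W_2k`
(`two_mul_socialWelfare_sub_le`). Weighted by `(2 ^ ℓ)⁻¹`, these bounds telescope to `W_1 - (2 ^
r)⁻¹ W_(2^r)` (`sub_le_sum_surplus`). Since `W_(2^r) ≤ n W` for the original optimum `W ≤ W_1`, and
`2 ^ r ≥ n ^ 2`, at least `W / 2` remains, to be averaged over `r + 1 = O(log n)` scales. -/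

/-- The value of `x` items (of all `m` items if `m < x`). -/
noncomputable def unitVal {m : ℕ} (v : MUSValuation m) (x : ℕ) : ℝ :=
  v.1.val (Finset.univ.filter fun j => j.val < x)

theorem card_filter_val_lt (m x : ℕ) :
    (Finset.univ.filter fun j : Fin m => j.val < x).card = min x m := by
  rw [Fin.card_filter_val_lt, min_comm]

theorem val_eq_unitVal {m : ℕ} (v : MUSValuation m) (S : Finset (Fin m)) :
    v.1.val S = unitVal v S.card := by
  refine v.2.1 _ _ ?_
  rw [card_filter_val_lt, min_eq_left]
  simpa using S.card_le_univ

theorem unitVal_mono {m : ℕ} (v : MUSValuation m) : Monotone (unitVal v) := by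
  intro x y h
  refine v.1.mono _ _ fun j => ?_
  simp only [Finset.mem_filter, Finset.mem_univ, true_and]
  omega

theorem unitVal_min {m : ℕ} (v : MUSValuation m) (x : ℕ) : unitVal v (min x m) = unitVal v x := by
  refine v.2.1 _ _ ?_
  rw [card_filter_val_lt, card_filter_val_lt]
  omega

/-- Submodularity is applied to two sets of size `x + 1` that share `x` items. Past `m` the function
is constant. -/
theorem unitVal_concave {m : ℕ} (v : MUSValuation m) (x : ℕ) :
    unitVal v (x + 2) - unitVal v (x + 1) ≤ unitVal v (x + 1) - unitVal v x := by
  by_cases h : x + 2 ≤ m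
  · set S := Finset.univ.filter fun j : Fin m => j.val < x + 1 with hS
    set T := insert (⟨x + 1, h⟩ : Fin m) (Finset.univ.filter fun j : Fin m => j.val < x) with hT
    have hsub := v.2.2 S T
    have hcard : T.card = x + 1 := by
      rw [hT, Finset.card_insert_of_notMem (by simp), card_filter_val_lt]
      omega
    have hint : S ∩ T = Finset.univ.filter fun j : Fin m => j.val < x := by
      ext j
      simp only [hS, hT, Finset.mem_inter, Finset.mem_filter, Finset.mem_univ, true_and,
        Finset.mem_insert, Fin.ext_iff]
      omega
    have huni : S ∪ T = Finset.univ.filter fun j : Fin m => j.val < x + 2 := by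
      ext j
      simp only [hS, hT, Finset.mem_union, Finset.mem_filter, Finset.mem_univ, true_and,
        Finset.mem_insert, Fin.ext_iff]
      omega
    rw [hint, huni, val_eq_unitVal v T, hcard] at hsub
    change unitVal v x + unitVal v (x + 2) ≤ unitVal v (x + 1) + unitVal v (x + 1) at hsub
    linarith
  · have h1 : unitVal v (x + 2) = unitVal v (x + 1) := by
      rw [← unitVal_min v (x + 2), ← unitVal_min v (x + 1)]
      congr 1
      omega
    have := unitVal_mono v (Nat.le_succ x)
    rw [h1]
    simpa using this

theorem unitVal_sub_antitone {m : ℕ} (v : MUSValuation m) :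
    Antitone fun x => unitVal v (x + 1) - unitVal v x :=
  antitone_nat_of_succ_le fun x => unitVal_concave v x

/-- A quantity whose marginal values enclose a price is a demand at that price. -/
theorem unitVal_le_of_price {m : ℕ} (v : MUSValuation m) {a : ℕ} {p : ℝ}
    (hnext : unitVal v (a + 1) - unitVal v a ≤ p)
    (hlast : ∀ c, a = c + 1 → p ≤ unitVal v (c + 1) - unitVal v c) (b : ℕ) :
    unitVal v b - p * b ≤ unitVal v a - p * a := by
  rcases le_total a b with hab | hab
  · induction b, hab using Nat.le_induction with
    | base => exact le_rfl
    | succ b hab ih =>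
      have := unitVal_sub_antitone v hab
      push_cast
      dsimp only at this
      linarith
  · induction hab using Nat.decreasingInduction with
    | self => exact le_rfl
    | of_succ b hab ih =>
      obtain ⟨c, rfl⟩ : ∃ c, a = c + 1 := ⟨a - 1, by omega⟩
      have h1 := unitVal_sub_antitone v (Nat.lt_succ_iff.mp hab)
      have h2 := hlast c rfl
      push_cast at *
      linarith

/-! ### Allocations of copies and quantities -/

theorem copyVal_eq_unitVal {n m k : ℕ} (v : Fin n → MUSValuation m) (i : Fin n)
    (S : Finset (Copies m k)) : copyVal k v i S = unitVal (v i) (project S).card :=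
  val_eq_unitVal _ _

theorem copyVal_le_unitVal {n m k : ℕ} (v : Fin n → MUSValuation m) (i : Fin n)
    (S : Finset (Copies m k)) : copyVal k v i S ≤ unitVal (v i) S.card := by
  rw [copyVal_eq_unitVal]
  exact unitVal_mono _ Finset.card_image_le

theorem sum_card_le_of_isAllocation {N J : Type} [DecidableEq J] {S : Finset J} {A : N → Finset J}
    (hA : IsAllocation S A) (P : Finset N) : ∑ i ∈ P, (A i).card ≤ S.card := by
  rw [← Finset.card_biUnion fun i _ j _ hij => hA.2 i j hij]
  exact Finset.card_le_card (Finset.biUnion_subset.mpr fun i _ => hA.1 i)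

theorem card_copies (m k : ℕ) : (Finset.univ : Finset (Copies m k)).card = k * m := by
  simp [Copies, mul_comm]

theorem position_lt {m k : ℕ} (x : Copies m k) : position x < k * m := by
  have h1 := x.1.isLt
  have h2 : x.2.val + 1 ≤ k := x.2.isLt
  have h3 := Nat.mul_le_mul_right m h2
  unfold position
  nlinarith

theorem position_mod {m k : ℕ} (x : Copies m k) : position x % m = x.1.val := by
  unfold position
  rw [Nat.mul_add_mod_self_right, Nat.mod_eq_of_lt x.1.isLt]

theorem position_injective {m k : ℕ} : Function.Injective (position : Copies m k → ℕ) := by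
  intro x y h
  have h1 : x.1 = y.1 := Fin.ext (by rw [← position_mod x, ← position_mod y, h])
  have h2 : x.2.val * m = y.2.val * m := by
    unfold position at h
    rw [h1] at h
    omega
  exact Prod.ext h1 (Fin.ext (Nat.eq_of_mul_eq_mul_right (by have := x.1.isLt; omega) h2))

theorem exists_position_eq {m k y : ℕ} (h : y < k * m) : ∃ x : Copies m k, position x = y := by
  have hm : 0 < m := Nat.pos_of_ne_zero fun h0 => by simp [h0] at h
  refine ⟨(⟨y % m, Nat.mod_lt _ hm⟩, ⟨y / m, (Nat.div_lt_iff_lt_mul hm).mpr h⟩), ?_⟩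
  simp only [position]
  rw [mul_comm]
  exact Nat.div_add_mod y m

/-- The copies at the positions `c, …, d - 1`. -/
def copyInterval (m k c d : ℕ) : Finset (Copies m k) :=
  Finset.univ.filter fun x => c ≤ position x ∧ position x < d

theorem mem_copyInterval {m k c d : ℕ} {x : Copies m k} :
    x ∈ copyInterval m k c d ↔ c ≤ position x ∧ position x < d := by
  simp [copyInterval]

theorem card_copyInterval {m k c d : ℕ} (hd : d ≤ k * m) :
    (copyInterval m k c d).card = d - c := by
  rw [← Finset.card_image_of_injective _ position_injective]
  have : (copyInterval m k c d).image position = Finset.Ico c d := by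
    ext y
    simp only [Finset.mem_image, mem_copyInterval, Finset.mem_Ico]
    constructor
    · rintro ⟨x, hx, rfl⟩
      exact hx
    · intro hy
      obtain ⟨x, rfl⟩ := exists_position_eq (m := m) (k := k) (hy.2.trans_le hd)
      exact ⟨x, hy, rfl⟩
  rw [this, Nat.card_Ico]

/-- Distinct copies of one item are at least `m` positions apart, too far for a window of length
`m`. -/
theorem eq_of_fst_eq_of_position {m k c d : ℕ} (hcd : d ≤ c + m) {x y : Copies m k}
    (hx : x ∈ copyInterval m k c d) (hy : y ∈ copyInterval m k c d) (h : x.1 = y.1) : x = y := by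
  rw [mem_copyInterval] at hx hy
  refine Prod.ext h (Fin.ext ?_)
  unfold position at hx hy
  rw [h] at hx
  rcases lt_trichotomy x.2.val y.2.val with hlt | heq | hlt
  · have := Nat.mul_le_mul_right m (Nat.succ_le_of_lt hlt)
    rw [Nat.succ_mul] at this
    omega
  · exact heq
  · have := Nat.mul_le_mul_right m (Nat.succ_le_of_lt hlt)
    rw [Nat.succ_mul] at this
    omega

theorem card_project_copyInterval {m k c d : ℕ} (hcd : d ≤ c + m) (hd : d ≤ k * m) :
    (project (copyInterval m k c d)).card = d - c := by
  rw [← card_copyInterval hd (c := c)]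
  exact Finset.card_image_of_injOn fun x hx y hy h => eq_of_fst_eq_of_position hcd hx hy h

/-- The consecutive intervals with `a 0, a 1, …` copies. -/
def consecutiveAlloc {n : ℕ} (m k : ℕ) (a : Fin n → ℕ) (i : Fin n) : Finset (Copies m k) :=
  copyInterval m k (Fin.partialSum a i.castSucc) (Fin.partialSum a i.succ)

theorem partialSum_monotone {n : ℕ} (a : Fin n → ℕ) : Monotone (Fin.partialSum a) := by
  refine Fin.monotone_iff_le_succ.mpr fun i => ?_
  rw [Fin.partialSum_succ]
  omega

theorem partialSum_le {n : ℕ} (a : Fin n → ℕ) (j : Fin (n + 1)) :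
    Fin.partialSum a j ≤ ∑ i, a i := by
  refine (partialSum_monotone a (Fin.le_last j)).trans_eq ?_
  simp [Fin.partialSum, Fin.sum_ofFn, List.take_of_length_le]

theorem isSequential_consecutiveAlloc {n : ℕ} (m k : ℕ) (a : Fin n → ℕ) :
    IsSequential (consecutiveAlloc m k a) :=
  ⟨Fin.partialSum a, Fin.partialSum_zero a, partialSum_monotone a, fun _ _ => mem_copyInterval⟩

theorem IsSequential.isAllocation {n m k : ℕ} {A : Fin n → Finset (Copies m k)}
    (hA : IsSequential A) : IsAllocation Finset.univ A := by
  obtain ⟨c, -, hc, hA⟩ := hA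
  have key : ∀ i j : Fin n, i < j → Disjoint (A i) (A j) := by
    intro i j hij
    rw [Finset.disjoint_left]
    intro x hx hy
    rw [hA] at hx hy
    have : c i.succ ≤ c j.castSucc := hc (Fin.succ_le_castSucc_iff.mpr hij)
    omega
  refine ⟨fun i => Finset.subset_univ _, fun i j hij => ?_⟩
  rcases lt_or_gt_of_ne hij with h | h
  · exact key i j h
  · exact (key j i h).symm

theorem copyVal_consecutiveAlloc {n m k : ℕ} (v : Fin n → MUSValuation m) {a : Fin n → ℕ}
    (ham : ∀ i, a i ≤ m) (ha : ∑ i, a i ≤ k * m) (i : Fin n) :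
    copyVal k v i (consecutiveAlloc m k a i) = unitVal (v i) (a i) := by
  have h := Fin.partialSum_succ a i
  have h1 := ham i
  rw [copyVal_eq_unitVal, consecutiveAlloc,
    card_project_copyInterval (by omega) ((partialSum_le a _).trans ha)]
  congr 1
  omega

theorem le_socialWelfare {N J : Type} [Finite N] [Finite J] (w : N → Finset J → ℝ) (P : Finset N)
    {S : Finset J} {A : N → Finset J} (hA : IsAllocation S A) :
    ∑ i ∈ P, w i (A i) ≤ socialWelfare w P S :=
  (socialWelfare_isGreatest w P S).2 ⟨A, hA, rfl⟩

theorem socialWelfare_le {N J : Type} [Finite N] [Finite J] {w : N → Finset J → ℝ} {P : Finset N}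
    {S : Finset J} {b : ℝ} (h : ∀ A, IsAllocation S A → ∑ i ∈ P, w i (A i) ≤ b) :
    socialWelfare w P S ≤ b := by
  obtain ⟨A, hA, hx⟩ := (socialWelfare_isGreatest w P S).1
  rw [hx]
  exact h A hA

/-- Capping quantities at `m` keeps their values, and capped quantities fit into consecutive
intervals without a repeated item. With `socialWelfare_copyVal_le` this reduces allocations of
copies to vectors of quantities. -/
theorem sum_unitVal_le_socialWelfare {n m k : ℕ} (v : Fin n → MUSValuation m) {a : Fin n → ℕ}
    (ha : ∑ i, a i ≤ k * m) :
    ∑ i, unitVal (v i) (a i) ≤ socialWelfare (copyVal k v) Finset.univ Finset.univ := by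
  have h1 : ∑ i, min (a i) m ≤ k * m :=
    (Finset.sum_le_sum fun i _ => min_le_left _ _).trans ha
  refine le_trans (le_of_eq ?_) (le_socialWelfare (copyVal k v) Finset.univ
    (isSequential_consecutiveAlloc m k fun i => min (a i) m).isAllocation)
  refine Finset.sum_congr rfl fun i _ => ?_
  rw [copyVal_consecutiveAlloc v (fun i => min_le_right _ _) h1, unitVal_min]

theorem socialWelfare_copyVal_le {n m k : ℕ} {v : Fin n → MUSValuation m} {P : Finset (Fin n)}
    {b : ℝ} (h : ∀ a : Fin n → ℕ, ∑ i ∈ P, a i ≤ k * m → ∑ i ∈ P, unitVal (v i) (a i) ≤ b) :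
    socialWelfare (copyVal k v) P Finset.univ ≤ b := by
  refine socialWelfare_le fun A hA => ?_
  refine (Finset.sum_le_sum fun i _ => copyVal_le_unitVal v i (A i)).trans (h _ ?_)
  simpa only [card_copies] using sum_card_le_of_isAllocation hA P

/-! ### Existence of implementations of the VCG step -/

theorem exists_vcg_allocation {n m : ℕ} (k : ℕ) (v : Fin n → MUSValuation m) :
    ∃ A : Fin n → Finset (Copies m k), IsWelfareMaximizing (copyVal k v) A ∧
      IsNonRedundant (copyVal k v) A ∧ IsSequential A := by
  classical
  set W := socialWelfare (copyVal k v) Finset.univ Finset.univ with hW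
  -- Among the optimal quantity vectors, one of least total is taken; minimality will give
  -- non-redundancy.
  have hex : ∃ s : ℕ, ∃ a : Fin n → ℕ, ∑ i, a i = s ∧ s ≤ k * m ∧
      W ≤ ∑ i, unitVal (v i) (a i) := by
    obtain ⟨A, hA, hx⟩ := (socialWelfare_isGreatest (copyVal k v) Finset.univ Finset.univ).1
    refine ⟨_, fun i => (A i).card, rfl, ?_, ?_⟩
    · simpa only [card_copies] using sum_card_le_of_isAllocation hA Finset.univ
    · rw [hW, hx]
      exact Finset.sum_le_sum fun i _ => copyVal_le_unitVal v i (A i)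
  obtain ⟨a, hs, hsk, haW⟩ := Nat.find_spec hex
  have hstrict : ∀ i c, a i = c + 1 → unitVal (v i) c < unitVal (v i) (c + 1) := by
    intro i c hc
    by_contra hcon
    have hsum : ∑ j, Function.update a i c j + 1 = ∑ j, a j := by
      rw [Finset.sum_update_of_mem (Finset.mem_univ i),
        ← Finset.add_sum_erase _ a (Finset.mem_univ i), hc, Finset.sdiff_singleton_eq_erase]
      ring
    refine Nat.find_min hex (m := ∑ j, Function.update a i c j) (by omega)
      ⟨Function.update a i c, rfl, by omega, haW.trans (Finset.sum_le_sum fun j _ => ?_)⟩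
    by_cases hj : j = i
    · subst hj
      rw [Function.update_self, hc]
      exact not_lt.mp hcon
    · rw [Function.update_of_ne hj]
  -- A unit beyond the `m`-th adds no value, against `hstrict`.
  have ham : ∀ i, a i ≤ m := by
    intro i
    by_contra hcon
    obtain ⟨c, hc⟩ : ∃ c, a i = c + 1 := ⟨a i - 1, by omega⟩
    have := hstrict i c hc
    rw [← unitVal_min _ c, ← unitVal_min _ (c + 1), show min c m = min (c + 1) m by omega] at this
    exact lt_irrefl _ this
  have hval := copyVal_consecutiveAlloc (k := k) v ham (hs.trans_le hsk)
  have hseq := isSequential_consecutiveAlloc m k a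
  refine ⟨consecutiveAlloc m k a, ⟨hseq.isAllocation, ?_⟩, ?_, hseq⟩
  · rw [Finset.sum_congr rfl fun i _ => hval i]
    exact le_antisymm (sum_unitVal_le_socialWelfare v (hs.trans_le hsk)) haW
  · intro i x hx
    have hcard : (consecutiveAlloc m k a i).card = a i := by
      rw [consecutiveAlloc, card_copyInterval ((partialSum_le a _).trans (hs.trans_le hsk)),
        Fin.partialSum_succ]
      omega
    obtain ⟨c, hc⟩ : ∃ c, a i = c + 1 := by
      have := Finset.card_pos.mpr ⟨x, hx⟩
      exact ⟨a i - 1, by omega⟩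
    rw [hval, hc]
    refine lt_of_le_of_lt ?_ (hstrict i c hc)
    refine (copyVal_le_unitVal v i _).trans_eq ?_
    rw [Finset.sdiff_singleton_eq_erase, Finset.card_erase_of_mem hx, hcard, hc]
    rfl

/-! ### Expectations under uniform choices -/

theorem hasSum_pure {α : Type} (x : α) (f : α → ℝ) :
    HasSum (fun o => (PMF.pure x o).toReal * f o) (f x) := by
  classical
  convert hasSum_ite_eq x (f x) using 2 with o
  rw [PMF.pure_apply]
  by_cases h : o = x
  · simp [h]
  · simp [h]

/-- `HasSum` rather than an equation of `tsum`s lets the nested random choices compose without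
separate summability proofs on the infinite outcome type. -/
theorem hasSum_uniformOfFintype_bind {α β : Type} [Fintype α] [Nonempty α] {κ : α → PMF β}
    {f : β → ℝ} {s : α → ℝ} (h : ∀ a, HasSum (fun o => (κ a o).toReal * f o) (s a)) :
    HasSum (fun o => (((PMF.uniformOfFintype α).bind κ) o).toReal * f o)
      ((Fintype.card α : ℝ)⁻¹ * ∑ a, s a) := by
  have hfun : (fun o => (((PMF.uniformOfFintype α).bind κ) o).toReal * f o) =
      fun o => (Fintype.card α : ℝ)⁻¹ * ∑ a, (κ a o).toReal * f o := by
    funext o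
    rw [PMF.bind_apply, tsum_fintype, ENNReal.toReal_sum fun a _ =>
      ENNReal.mul_ne_top (PMF.apply_ne_top _ _) (PMF.apply_ne_top _ _), Finset.sum_mul,
      Finset.mul_sum]
    refine Finset.sum_congr rfl fun a _ => ?_
    rw [PMF.uniformOfFintype_apply, ENNReal.toReal_mul, ENNReal.toReal_inv,
      ENNReal.toReal_natCast, mul_assoc]
  rw [hfun]
  exact (hasSum_sum fun a _ => h a).mul_left _

theorem hasSum_intervalRounding {n m ℓ : ℕ} (A : Fin n → Finset (Copies m (2 ^ ℓ)))
    (p : Fin n → ℝ) (f : Outcome n m → ℝ) :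
    HasSum (fun o => (intervalRounding n m ℓ A p o).toReal * f o)
      ((2 ^ ℓ : ℝ)⁻¹ * ∑ t, 2⁻¹ *
        (f (serve A p (withinCopy A t)) + f (serve A p (acrossCopies A t)))) := by
  have h := hasSum_uniformOfFintype_bind (f := f) fun t : Fin (2 ^ ℓ) =>
    hasSum_uniformOfFintype_bind (f := f) fun b : Bool =>
      hasSum_pure (serve A p (if b then withinCopy A t else acrossCopies A t)) f
  simpa [intervalRounding, PMF.map, Function.comp_def] using h

theorem expect_vcgWithCopies {n m : ℕ} (r : ℕ) (alloc : AllocationRule n m)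
    (v : Fin n → MUSValuation m) (f : Outcome n m → ℝ) :
    expect (vcgWithCopies r alloc (intervalRounding n m) v) f =
      ((r : ℝ) + 1)⁻¹ * ∑ ℓ : Fin (r + 1), (2 ^ (ℓ : ℕ) : ℝ)⁻¹ * ∑ t, 2⁻¹ *
        (f (serve (alloc ℓ v) (vcgPayment (copyVal (2 ^ (ℓ : ℕ)) v) (alloc ℓ v))
            (withinCopy (alloc ℓ v) t)) +
          f (serve (alloc ℓ v) (vcgPayment (copyVal (2 ^ (ℓ : ℕ)) v) (alloc ℓ v))
            (acrossCopies (alloc ℓ v) t))) := by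
  have h := (hasSum_uniformOfFintype_bind (f := f) fun ℓ : Fin (r + 1) =>
    hasSum_intervalRounding (alloc ℓ v) (vcgPayment (copyVal (2 ^ (ℓ : ℕ)) v) (alloc ℓ v)) f).tsum_eq
  simpa [expect, vcgWithCopies] using h

theorem exists_serve_of_mem_support {n m r : ℕ} {alloc : AllocationRule n m}
    {v : Fin n → MUSValuation m} {o : Outcome n m}
    (ho : o ∈ (vcgWithCopies r alloc (intervalRounding n m) v).support) :
    ∃ (ℓ : ℕ) (t : Fin (2 ^ ℓ)) (T : Finset (Fin n)),
      (T = withinCopy (alloc ℓ v) t ∨ T = acrossCopies (alloc ℓ v) t) ∧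
      o = serve (alloc ℓ v) (vcgPayment (copyVal (2 ^ ℓ) v) (alloc ℓ v)) T := by
  simp only [vcgWithCopies, intervalRounding, PMF.mem_support_bind_iff, PMF.mem_support_map_iff]
    at ho
  obtain ⟨ℓ, -, t, -, b, -, rfl⟩ := ho
  refine ⟨ℓ, t, _, ?_, rfl⟩
  cases b
  · right; rfl
  · left; rfl

/-! ### The VCG mechanism -/

theorem socialWelfare_mono {N J : Type} [Finite N] [Finite J] (w : N → Finset J → ℝ)
    (P : Finset N) {S T : Finset J} (h : S ⊆ T) : socialWelfare w P S ≤ socialWelfare w P T :=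
  socialWelfare_le fun _ hA => le_socialWelfare w P ⟨fun i => (hA.1 i).trans h, hA.2⟩

theorem socialWelfare_congr {N J : Type} {w w' : N → Finset J → ℝ} {P : Finset N}
    (h : ∀ i ∈ P, w i = w' i) (S : Finset J) : socialWelfare w P S = socialWelfare w' P S := by
  have : ∀ A : N → Finset J, ∑ i ∈ P, w i (A i) = ∑ i ∈ P, w' i (A i) := fun A =>
    Finset.sum_congr rfl fun i hi => by rw [h i hi]
  simp only [socialWelfare, this]

theorem socialWelfare_erase_le {N J : Type} [Fintype N] [DecidableEq N] [Finite J]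
    {w : N → Finset J → ℝ} (hw : ∀ i S, 0 ≤ w i S) (i : N) (S : Finset J) :
    socialWelfare w (Finset.univ.erase i) S ≤ socialWelfare w Finset.univ S :=
  socialWelfare_le fun A hA => (Finset.sum_le_sum_of_subset_of_nonneg (Finset.erase_subset _ _)
    fun j _ _ => hw j (A j)).trans (le_socialWelfare w Finset.univ hA)

section VCG

variable {N J : Type} [Fintype N] [DecidableEq N] [Fintype J] [DecidableEq J]
  {w : N → Finset J → ℝ} {A : N → Finset J}

theorem vcgPayment_nonneg (w : N → Finset J → ℝ) (A : N → Finset J) (i : N) :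
    0 ≤ vcgPayment w A i :=
  sub_nonneg.mpr (socialWelfare_mono _ _ (Finset.subset_univ _))

/-- Giving `S` to `i` and dividing the rest optimally among the others is one feasible allocation.
-/
theorem add_socialWelfare_erase_le (w : N → Finset J → ℝ) (i : N) (S : Finset J) :
    w i S + socialWelfare w (Finset.univ.erase i) (Finset.univ \ S) ≤
      socialWelfare w Finset.univ Finset.univ := by
  obtain ⟨B, hB, hx⟩ := (socialWelfare_isGreatest w (Finset.univ.erase i) (Finset.univ \ S)).1
  have hdisj : ∀ j, Disjoint S (B j) := fun j =>
    (Finset.disjoint_sdiff (s := S) (t := Finset.univ)).mono_right (hB.1 j)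
  have hall : IsAllocation Finset.univ (Function.update B i S) := by
    refine ⟨fun j => Finset.subset_univ _, fun j j' hj => ?_⟩
    by_cases h : j = i
    · subst h
      rw [Function.update_self, Function.update_of_ne hj.symm]
      exact hdisj j'
    · rw [Function.update_of_ne h]
      by_cases h' : j' = i
      · subst h'
        rw [Function.update_self]
        exact (hdisj j).symm
      · rw [Function.update_of_ne h']
        exact hB.2 j j' hj
  refine le_trans (le_of_eq ?_) (le_socialWelfare w Finset.univ hall)
  rw [hx, ← Finset.add_sum_erase _ _ (Finset.mem_univ i), Function.update_self]
  congr 1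
  refine Finset.sum_congr rfl fun j hj => ?_
  rw [Function.update_of_ne (Finset.ne_of_mem_erase hj)]

/-- The payment of `i` depends on `i`'s report only through the bundle, so the upper bound is the
same for all reports. Truthful reporting attains it, by `IsWelfareMaximizing.sub_vcgPayment`. -/
theorem sub_vcgPayment_le (w w' : N → Finset J → ℝ) {i : N} (h : ∀ j, j ≠ i → w' j = w j)
    (A : N → Finset J) :
    w i (A i) - vcgPayment w' A i ≤ socialWelfare w Finset.univ Finset.univ -
      socialWelfare w (Finset.univ.erase i) Finset.univ := by
  have := add_socialWelfare_erase_le w i (A i)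
  have hc : ∀ j ∈ Finset.univ.erase i, w' j = w j := fun j hj => h j (Finset.ne_of_mem_erase hj)
  rw [vcgPayment, socialWelfare_congr hc, socialWelfare_congr hc]
  linarith

theorem IsWelfareMaximizing.sub_vcgPayment (hA : IsWelfareMaximizing w A) (i : N) :
    w i (A i) - vcgPayment w A i = socialWelfare w Finset.univ Finset.univ -
      socialWelfare w (Finset.univ.erase i) Finset.univ := by
  refine le_antisymm (sub_vcgPayment_le w w (fun _ _ => rfl) A) ?_
  have hall : IsAllocation (Finset.univ \ A i) (fun j => if j = i then ∅ else A j) := by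
    refine ⟨fun j => ?_, fun j j' hj => ?_⟩
    · dsimp only
      split_ifs with h
      · exact Finset.empty_subset _
      · exact Finset.subset_sdiff.mpr ⟨Finset.subset_univ _, hA.1.2 j i h⟩
    · dsimp only
      split_ifs
      · exact Finset.disjoint_empty_left _
      · exact Finset.disjoint_empty_left _
      · exact Finset.disjoint_empty_right _
      · exact hA.1.2 j j' hj
  have h1 := le_socialWelfare w (Finset.univ.erase i) hall
  have h2 : ∑ j ∈ Finset.univ.erase i, w j (if j = i then ∅ else A j) =
      ∑ j ∈ Finset.univ.erase i, w j (A j) :=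
    Finset.sum_congr rfl fun j hj => by rw [if_neg (Finset.ne_of_mem_erase hj)]
  have h3 := hA.2
  rw [← Finset.add_sum_erase _ _ (Finset.mem_univ i)] at h3
  rw [vcgPayment]
  linarith

theorem vcgPayment_eq_zero {i : N} (h : A i = ∅) : vcgPayment w A i = 0 := by
  rw [vcgPayment, h, Finset.sdiff_empty, sub_self]

end VCG

theorem copyVal_nonneg {n m k : ℕ} (v : Fin n → MUSValuation m) (i : Fin n)
    (S : Finset (Copies m k)) : 0 ≤ copyVal k v i S :=
  (v i).1.nonneg _

/-! ### Interval-based rounding -/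

/-- Removing one of two copies of the same item would leave the projection, hence the value,
unchanged. -/
theorem IsNonRedundant.injOn_fst {n m k : ℕ} {v : Fin n → MUSValuation m}
    {A : Fin n → Finset (Copies m k)} (hA : IsNonRedundant (copyVal k v) A) (i : Fin n) :
    Set.InjOn Prod.fst (A i : Set (Copies m k)) := by
  intro x hx y hy hxy
  by_contra hne
  have h := hA i x hx
  have hp : project (A i \ {x}) = project (A i) := by
    refine (Finset.image_subset_image Finset.sdiff_subset).antisymm fun j hj => ?_
    obtain ⟨z, hz, rfl⟩ := Finset.mem_image.mp hj
    by_cases hzx : z = x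
    · exact Finset.mem_image.mpr ⟨y, by simp [Finset.mem_coe.mp hy, Ne.symm hne], by rw [hzx, hxy]⟩
    · exact Finset.mem_image.mpr ⟨z, by simp [hz, hzx], rfl⟩
  rw [copyVal, copyVal, hp] at h
  exact lt_irrefl _ h

theorem IsNonRedundant.copyVal_eq {n m k : ℕ} {v : Fin n → MUSValuation m}
    {A : Fin n → Finset (Copies m k)} (hA : IsNonRedundant (copyVal k v) A) (i : Fin n) :
    copyVal k v i (A i) = unitVal (v i) (A i).card := by
  rw [copyVal_eq_unitVal, project, Finset.card_image_of_injOn (hA.injOn_fst i)]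

theorem mem_withinCopy {n m k : ℕ} {A : Fin n → Finset (Copies m k)} {t : Fin k} {i : Fin n} :
    i ∈ withinCopy A t ↔ (A i).Nonempty ∧ ∀ x ∈ A i, x.2 = t := by
  simp [withinCopy]

theorem mem_acrossCopies {n m k : ℕ} {A : Fin n → Finset (Copies m k)} {t : Fin k} {i : Fin n} :
    i ∈ acrossCopies A t ↔ (∃ x ∈ A i, x.2 = t) ∧ ∃ x ∈ A i, x.2.val = t.val + 1 := by
  simp [acrossCopies]

theorem position_lt_position {m k : ℕ} {x y : Copies m k} (h : x.2 < y.2) :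
    position x < position y := by
  have h1 := Nat.mul_le_mul_right m (Nat.succ_le_of_lt (Fin.lt_def.mp h))
  have := x.1.isLt
  rw [Nat.succ_mul] at h1
  unfold position
  omega

/-- An interval that contains at most one copy of each item meets at most two consecutive copies
of the item set. -/
theorem IsSequential.snd_le_succ {n m k : ℕ} {A : Fin n → Finset (Copies m k)}
    (hA : IsSequential A) {i : Fin n} (hinj : Set.InjOn Prod.fst (A i : Set (Copies m k)))
    {x y : Copies m k} (hx : x ∈ A i) (hy : y ∈ A i) : y.2.val ≤ x.2.val + 1 := by
  by_contra hlt
  obtain ⟨c, -, -, hc⟩ := hA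
  have hyk := y.2.isLt
  -- The copy of `x`'s item one layer up lies strictly between `x` and `y`, so the interval would
  -- contain it as a second copy of that item.
  set z : Copies m k := (x.1, ⟨x.2.val + 1, by omega⟩) with hz
  have hxz : position x < position z := position_lt_position (by simp [hz, Fin.lt_def])
  have hzy : position z < position y :=
    position_lt_position (by simp only [hz, Fin.lt_def]; omega)
  have hzA : z ∈ A i := by
    rw [hc] at hx hy ⊢
    omega
  have hxz' : x = z := hinj hx hzA rfl
  rw [← hxz'] at hxz
  exact lt_irrefl _ hxz

/-- Over all choices of the rounding, each agent with a nonempty bundle is served once. -/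
theorem sum_serve_eq {n m k : ℕ} {A : Fin n → Finset (Copies m k)} (hA : IsSequential A)
    {i : Fin n} (hinj : Set.InjOn Prod.fst (A i : Set (Copies m k))) (hne : (A i).Nonempty)
    (b : ℝ) :
    ∑ t, ((if i ∈ withinCopy A t then b else 0) + (if i ∈ acrossCopies A t then b else 0)) = b := by
  -- Only the lowest layer met by the bundle contributes: through `withinCopy` if the bundle stays
  -- there, through `acrossCopies` otherwise.
  obtain ⟨x₀, hx₀, hmin⟩ := (A i).exists_min_image (fun x => x.2) hne
  rw [Finset.sum_eq_single x₀.2]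
  · by_cases h : ∀ x ∈ A i, x.2 = x₀.2
    · rw [if_pos (mem_withinCopy.mpr ⟨hne, h⟩), if_neg, add_zero]
      rw [mem_acrossCopies]
      rintro ⟨-, y, hy, hy2⟩
      rw [h y hy] at hy2
      omega
    · rw [if_neg fun h' => h (mem_withinCopy.mp h').2, if_pos, zero_add]
      push Not at h
      obtain ⟨y, hy, hy2⟩ := h
      refine mem_acrossCopies.mpr ⟨⟨x₀, hx₀, rfl⟩, y, hy, ?_⟩
      have h1 := hA.snd_le_succ hinj hx₀ hy
      have h2 := Fin.le_def.mp (hmin y hy)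
      have h3 := Fin.val_ne_of_ne hy2
      omega
  · intro t _ ht
    rw [if_neg fun h => ht ((mem_withinCopy.mp h).2 x₀ hx₀).symm, if_neg, add_zero]
    rw [mem_acrossCopies]
    rintro ⟨⟨x, hx, rfl⟩, y, hy, hy2⟩
    have h1 := hA.snd_le_succ hinj hx₀ hy
    have h2 := Fin.le_def.mp (hmin x hx)
    exact ht (Fin.ext (by omega))
  · simp

theorem utility_serve {n m k : ℕ} (u : MUSValuation m) (A : Fin n → Finset (Copies m k))
    (p : Fin n → ℝ) (T : Finset (Fin n)) (i : Fin n) :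
    utility u i (serve A p T) = if i ∈ T then u.1.val (project (A i)) - p i else 0 := by
  by_cases h : i ∈ T
  · simp [utility, serve, h]
  · simp [utility, serve, h, u.1.empty]

theorem sum_utility_serve {n m k : ℕ} {w : Fin n → Finset (Copies m k) → ℝ} (u : MUSValuation m)
    {A : Fin n → Finset (Copies m k)} (hA : IsSequential A) {i : Fin n}
    (hinj : Set.InjOn Prod.fst (A i : Set (Copies m k))) :
    ∑ t, 2⁻¹ * (utility u i (serve A (vcgPayment w A) (withinCopy A t)) +
        utility u i (serve A (vcgPayment w A) (acrossCopies A t))) =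
      2⁻¹ * (u.1.val (project (A i)) - vcgPayment w A i) := by
  simp only [utility_serve]
  rw [← Finset.mul_sum]
  congr 1
  rcases (A i).eq_empty_or_nonempty with h | h
  · have h0 : u.1.val (project (A i)) - vcgPayment w A i = 0 := by
      rw [vcgPayment_eq_zero h, h]
      simp [project, u.1.empty]
    simp [h0]
  · exact sum_serve_eq hA hinj h _

/-- The valuation `u` is kept apart from the reported profile `v`, so that one formula covers
truthful reports and misreports. -/
theorem expect_utility {n m r : ℕ} {alloc : AllocationRule n m} (h : IsVCGImplementation alloc)
    (v : Fin n → MUSValuation m) (u : MUSValuation m) (i : Fin n) :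
    expect (vcgWithCopies r alloc (intervalRounding n m) v) (utility u i) =
      ((r : ℝ) + 1)⁻¹ * ∑ ℓ : Fin (r + 1), (2 ^ (ℓ : ℕ) : ℝ)⁻¹ * (2⁻¹ *
        (u.1.val (project (alloc ℓ v i)) -
          vcgPayment (copyVal (2 ^ (ℓ : ℕ)) v) (alloc ℓ v) i)) := by
  rw [expect_vcgWithCopies]
  refine congrArg _ (Finset.sum_congr rfl fun ℓ _ => ?_)
  rw [sum_utility_serve u (h ℓ v).2.2 ((h ℓ v).2.1.injOn_fst i)]

theorem expect_sum_utility {n m r : ℕ} {alloc : AllocationRule n m}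
    (h : IsVCGImplementation alloc) (v : Fin n → MUSValuation m) :
    expect (vcgWithCopies r alloc (intervalRounding n m) v) (fun o => ∑ i, utility (v i) i o) =
      ((r : ℝ) + 1)⁻¹ * ∑ ℓ : Fin (r + 1), (2 ^ (ℓ : ℕ) : ℝ)⁻¹ * (2⁻¹ *
        ∑ i, (socialWelfare (copyVal (2 ^ (ℓ : ℕ)) v) Finset.univ Finset.univ -
          socialWelfare (copyVal (2 ^ (ℓ : ℕ)) v) (Finset.univ.erase i) Finset.univ)) := by
  rw [expect_vcgWithCopies]
  refine congrArg _ (Finset.sum_congr rfl fun ℓ _ => congrArg _ ?_)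
  simp only [← Finset.sum_add_distrib, Finset.mul_sum]
  rw [Finset.sum_comm]
  refine Finset.sum_congr rfl fun i _ => ?_
  rw [sum_utility_serve (v i) (h ℓ v).2.2 ((h ℓ v).2.1.injOn_fst i),
    ← (h ℓ v).1.sub_vcgPayment i]
  rfl

/-! ### Feasibility and incentives -/

/-- For `i < j`, a copy of `i` in layer `t + 1` would come after a copy of `j` in layer `t`, against
the order of the intervals. -/
theorem IsSequential.card_acrossCopies_le {n m k : ℕ} {A : Fin n → Finset (Copies m k)}
    (hA : IsSequential A) {t : Fin k} {i j : Fin n} (hi : i ∈ acrossCopies A t)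
    (hj : j ∈ acrossCopies A t) : i = j := by
  obtain ⟨c, -, hc, hA⟩ := hA
  have key : ∀ i j : Fin n, i ∈ acrossCopies A t → j ∈ acrossCopies A t → ¬ i < j := by
    intro i j hi hj hij
    obtain ⟨-, y, hy, hyt⟩ := mem_acrossCopies.mp hi
    obtain ⟨⟨x, hx, hxt⟩, -⟩ := mem_acrossCopies.mp hj
    have h : c i.succ ≤ c j.castSucc := hc (Fin.succ_le_castSucc_iff.mpr hij)
    have h' : position x < position y := position_lt_position (by
      rw [Fin.lt_def, hyt, hxt]
      omega)
    rw [hA] at hx hy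
    omega
  exact le_antisymm (not_lt.mp (key j i hj hi)) (not_lt.mp (key i j hi hj))

theorem isAllocation_serve {n m k : ℕ} {A : Fin n → Finset (Copies m k)} (hA : IsSequential A)
    (p : Fin n → ℝ) {t : Fin k} {T : Finset (Fin n)}
    (hT : T = withinCopy A t ∨ T = acrossCopies A t) :
    IsAllocation Finset.univ (serve A p T).alloc := by
  refine ⟨fun i => Finset.subset_univ _, fun i j hij => ?_⟩
  simp only [serve]
  by_cases hi : i ∈ T
  · by_cases hj : j ∈ T
    · rw [if_pos hi, if_pos hj]
      rcases hT with rfl | rfl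
      · rw [Finset.disjoint_left]
        intro a hai haj
        obtain ⟨x, hx, rfl⟩ := Finset.mem_image.mp hai
        obtain ⟨y, hy, hxy⟩ := Finset.mem_image.mp haj
        have hx2 := (mem_withinCopy.mp hi).2 x hx
        have hy2 := (mem_withinCopy.mp hj).2 y hy
        have : y = x := Prod.ext hxy (hy2.trans hx2.symm)
        subst this
        exact Finset.disjoint_left.mp (hA.isAllocation.2 i j hij) hx hy
      · exact absurd (hA.card_acrossCopies_le hi hj) hij
    · rw [if_neg hj]
      exact Finset.disjoint_empty_right _
  · rw [if_neg hi]
    exact Finset.disjoint_empty_left _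

theorem isFeasible_vcgWithCopies {n m : ℕ} (r : ℕ) {alloc : AllocationRule n m}
    (h : IsVCGImplementation alloc) :
    (vcgWithCopies r alloc (intervalRounding n m)).IsFeasible := by
  intro v o ho
  obtain ⟨ℓ, t, T, hT, rfl⟩ := exists_serve_of_mem_support ho
  refine ⟨isAllocation_serve (h ℓ v).2.2 _ hT, fun i => ?_⟩
  simp only [serve]
  split_ifs
  · exact vcgPayment_nonneg _ _ _
  · exact le_rfl

theorem isEPIR_vcgWithCopies {n m : ℕ} (r : ℕ) {alloc : AllocationRule n m}
    (h : IsVCGImplementation alloc) :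
    (vcgWithCopies r alloc (intervalRounding n m)).IsEPIR := by
  intro v o ho i
  obtain ⟨ℓ, t, T, -, rfl⟩ := exists_serve_of_mem_support ho
  rw [utility_serve]
  split_ifs
  · have h1 := (h ℓ v).1.sub_vcgPayment i
    have h2 := socialWelfare_erase_le (copyVal_nonneg (k := 2 ^ ℓ) v) i Finset.univ
    change 0 ≤ copyVal (2 ^ ℓ) v i (alloc ℓ v i) - _
    linarith
  · exact le_rfl

theorem isTIE_vcgWithCopies {n m : ℕ} (r : ℕ) {alloc : AllocationRule n m}
    (h : IsVCGImplementation alloc) :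
    (vcgWithCopies r alloc (intervalRounding n m)).IsTIE := by
  intro v i u
  rw [expect_utility h, expect_utility h]
  refine mul_le_mul_of_nonneg_left (Finset.sum_le_sum fun ℓ _ => ?_) (by positivity)
  refine mul_le_mul_of_nonneg_left (mul_le_mul_of_nonneg_left ?_ (by norm_num)) (by positivity)
  refine (sub_vcgPayment_le (copyVal (2 ^ (ℓ : ℕ)) v) _ (fun j hj => ?_) _).trans_eq
    ((h ℓ v).1.sub_vcgPayment i).symm
  funext S
  rw [copyVal, copyVal, Function.update_of_ne hj]

/-! ### Market-clearing prices -/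

theorem sum_apply_update {n : ℕ} (g : Fin n → ℕ → ℝ) (a : Fin n → ℕ) (i : Fin n) (x : ℕ) :
    ∑ l, g l (Function.update a i x l) = ∑ l, g l (a l) + (g i x - g i (a i)) := by
  rw [← Finset.add_sum_erase _ _ (Finset.mem_univ i),
    ← Finset.add_sum_erase _ (fun l => g l (a l)) (Finset.mem_univ i), Function.update_self,
    Finset.sum_congr rfl fun l hl => by rw [Function.update_of_ne (Finset.ne_of_mem_erase hl)]]
  ring

/-- The price is the largest value any agent has for one more unit. If supply is left over,
optimality forces it to be zero, which is the complementary slackness condition. -/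
theorem exists_price {n m K : ℕ} (v : Fin n → MUSValuation m) {a : Fin n → ℕ}
    (ha : ∑ i, a i ≤ K)
    (hopt : ∀ b : Fin n → ℕ, ∑ i, b i ≤ K → ∑ i, unitVal (v i) (b i) ≤ ∑ i, unitVal (v i) (a i)) :
    ∃ p : ℝ, 0 ≤ p ∧ p * (K - ∑ i, (a i : ℝ)) = 0 ∧
      ∀ i (b : ℕ), unitVal (v i) b - p * b ≤ unitVal (v i) (a i) - p * a i := by
  rcases isEmpty_or_nonempty (Fin n) with hn | hn
  · exact ⟨0, le_rfl, zero_mul _, fun i => hn.elim i⟩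
  obtain ⟨j, hj⟩ := Finite.exists_max fun i => unitVal (v i) (a i + 1) - unitVal (v i) (a i)
  have hcard : ∀ (c : Fin n → ℕ) (i : Fin n) (x : ℕ),
      ∑ l, Function.update c i x l + c i = ∑ l, c l + x := by
    intro c i x
    have := sum_apply_update (fun _ y => (y : ℝ)) c i x
    have h2 : ((∑ l, Function.update c i x l + c i : ℕ) : ℝ) = ((∑ l, c l + x : ℕ) : ℝ) := by
      push_cast
      linarith
    exact_mod_cast h2
  have hp : 0 ≤ unitVal (v j) (a j + 1) - unitVal (v j) (a j) :=
    sub_nonneg.mpr (unitVal_mono _ (Nat.le_succ _))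
  refine ⟨_, hp, ?_, fun i b => unitVal_le_of_price (v i) (hj i) ?_ b⟩
  · rcases ha.eq_or_lt with h | h
    · have : (K : ℝ) = ∑ i, (a i : ℝ) := by rw [← h, Nat.cast_sum]
      rw [this, sub_self, mul_zero]
    · have h1 := hcard a j (a j + 1)
      have h2 := hopt (Function.update a j (a j + 1)) (by omega)
      rw [sum_apply_update fun i => unitVal (v i)] at h2
      rw [le_antisymm (by linarith) hp, zero_mul]
  · intro c hc
    by_cases hij : j = i
    · subst hij
      rw [hc]
      exact unitVal_concave _ _
    -- Exchange: moving `i`'s last unit to `j`, who values a further unit at the price, cannot raise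
    -- the welfare.
    · have h1 := hcard a i c
      have h2 := hcard (Function.update a i c) j (a j + 1)
      rw [Function.update_of_ne hij] at h2
      have h3 := hopt (Function.update (Function.update a i c) j (a j + 1)) (by omega)
      rw [sum_apply_update fun i => unitVal (v i), sum_apply_update fun i => unitVal (v i),
        Function.update_of_ne hij, hc] at h3
      linarith

/-! ### The residual surplus -/

/-- Doubling the number of copies: the VCG surplus is bounded below by the welfare lost by
halving the supply. -/
theorem two_mul_socialWelfare_sub_le {n m k : ℕ} {v : Fin n → MUSValuation m}
    {A : Fin n → Finset (Copies m (2 * k))} (hA : IsWelfareMaximizing (copyVal (2 * k) v) A)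
    (hA' : IsNonRedundant (copyVal (2 * k) v) A) :
    2 * socialWelfare (copyVal k v) Finset.univ Finset.univ -
        socialWelfare (copyVal (2 * k) v) Finset.univ Finset.univ ≤
      ∑ i, (socialWelfare (copyVal (2 * k) v) Finset.univ Finset.univ -
        socialWelfare (copyVal (2 * k) v) (Finset.univ.erase i) Finset.univ) := by
  have hW : socialWelfare (copyVal (2 * k) v) Finset.univ Finset.univ =
      ∑ i, unitVal (v i) (A i).card := by
    rw [← hA.2]
    exact Finset.sum_congr rfl fun i _ => hA'.copyVal_eq i
  have hsum : ∑ i, (A i).card ≤ 2 * k * m := by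
    simpa only [card_copies] using sum_card_le_of_isAllocation hA.1 Finset.univ
  obtain ⟨p, hp, hpK, hdem⟩ := exists_price v hsum fun b hb =>
    (sum_unitVal_le_socialWelfare v hb).trans_eq hW
  -- Weak duality: the price for `2 * k` copies bounds the welfare of every group of agents at every
  -- supply.
  have hbound : ∀ (P : Finset (Fin n)) (k' : ℕ),
      socialWelfare (copyVal k' v) P Finset.univ ≤
        p * (k' * m : ℕ) + ∑ i ∈ P, (unitVal (v i) (A i).card - p * (A i).card) := by
    intro P k'
    refine socialWelfare_copyVal_le fun b hb => ?_
    have h1 := Finset.sum_le_sum fun i (_ : i ∈ P) => hdem i (b i)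
    have h2 : (∑ i ∈ P, (b i : ℝ)) ≤ (k' * m : ℕ) := by exact_mod_cast hb
    have h3 := mul_le_mul_of_nonneg_left h2 hp
    rw [Finset.sum_sub_distrib, ← Finset.mul_sum] at h1
    linarith
  have hhalf := hbound Finset.univ k
  rw [Finset.sum_sub_distrib, ← Finset.mul_sum, ← hW] at hhalf
  -- VCG leaves each agent at least the utility obtained at the clearing price.
  have hterm : ∀ i, unitVal (v i) (A i).card - p * (A i).card ≤
      socialWelfare (copyVal (2 * k) v) Finset.univ Finset.univ -
        socialWelfare (copyVal (2 * k) v) (Finset.univ.erase i) Finset.univ := by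
    intro i
    have h1 := hbound (Finset.univ.erase i) (2 * k)
    have h2 := Finset.add_sum_erase Finset.univ
      (fun i => unitVal (v i) (A i).card - p * (A i).card) (Finset.mem_univ i)
    have h3 : ∑ i, (unitVal (v i) (A i).card - p * (A i).card) =
        socialWelfare (copyVal (2 * k) v) Finset.univ Finset.univ - p * ∑ i, ((A i).card : ℝ) := by
      rw [Finset.sum_sub_distrib, ← Finset.mul_sum, ← hW]
    rw [mul_sub] at hpK
    linarith
  refine le_trans ?_ (Finset.sum_le_sum fun i _ => hterm i)
  rw [Finset.sum_sub_distrib, ← Finset.mul_sum, ← hW]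
  rw [mul_sub] at hpK
  push_cast at hhalf hpK
  linarith

theorem socialWelfare_le_copyVal_one {n m : ℕ} (v : Fin n → MUSValuation m) :
    socialWelfare (fun i => (v i).1.val) Finset.univ Finset.univ ≤
      socialWelfare (copyVal 1 v) Finset.univ Finset.univ := by
  refine socialWelfare_le fun A hA => ?_
  simp only [val_eq_unitVal]
  refine sum_unitVal_le_socialWelfare v ?_
  simpa using sum_card_le_of_isAllocation hA Finset.univ

/-- However many copies exist, the projected bundle of one agent is available in the original
instance, so it is worth at most the original optimum. -/
theorem socialWelfare_copyVal_le_mul {n m k : ℕ} (v : Fin n → MUSValuation m) :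
    socialWelfare (copyVal k v) Finset.univ Finset.univ ≤
      n * socialWelfare (fun i => (v i).1.val) Finset.univ Finset.univ := by
  classical
  refine socialWelfare_le fun A _ => ?_
  have h : ∀ i, copyVal k v i (A i) ≤
      socialWelfare (fun i => (v i).1.val) Finset.univ Finset.univ := by
    intro i
    have h1 := add_socialWelfare_erase_le (fun i => (v i).1.val) i (project (A i))
    have h2 : 0 ≤ socialWelfare (fun i => (v i).1.val) (Finset.univ.erase i)
        (Finset.univ \ project (A i)) := by
      refine le_trans ?_ (le_socialWelfare _ _ (A := fun _ => ∅)
        ⟨fun _ => Finset.empty_subset _, fun _ _ _ => Finset.disjoint_empty_left _⟩)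
      exact Finset.sum_nonneg fun j _ => (v j).1.nonneg _
    rw [copyVal]
    linarith
  refine (Finset.sum_le_sum fun i _ => h i).trans_eq ?_
  simp

theorem telescoping_le_sum {D s : ℕ → ℝ} (h0 : 0 ≤ s 0)
    (h : ∀ ℓ, D ℓ - D (ℓ + 1) ≤ s (ℓ + 1)) (r : ℕ) :
    D 0 - D r ≤ ∑ ℓ ∈ Finset.range (r + 1), s ℓ := by
  induction r with
  | zero => simpa using h0
  | succ r ih =>
    rw [Finset.sum_range_succ]
    linarith [h r]

theorem sub_le_sum_surplus {n m : ℕ} {alloc : AllocationRule n m}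
    (h : IsVCGImplementation alloc) (v : Fin n → MUSValuation m) (r : ℕ) :
    socialWelfare (copyVal 1 v) Finset.univ Finset.univ -
        (2 ^ r : ℝ)⁻¹ * socialWelfare (copyVal (2 ^ r) v) Finset.univ Finset.univ ≤
      ∑ ℓ : Fin (r + 1), (2 ^ (ℓ : ℕ) : ℝ)⁻¹ *
        ∑ i, (socialWelfare (copyVal (2 ^ (ℓ : ℕ)) v) Finset.univ Finset.univ -
          socialWelfare (copyVal (2 ^ (ℓ : ℕ)) v) (Finset.univ.erase i) Finset.univ) := by
  set s : ℕ → ℝ := fun ℓ => (2 ^ ℓ : ℝ)⁻¹ *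
    ∑ i, (socialWelfare (copyVal (2 ^ ℓ) v) Finset.univ Finset.univ -
      socialWelfare (copyVal (2 ^ ℓ) v) (Finset.univ.erase i) Finset.univ) with hs
  set D : ℕ → ℝ := fun ℓ => (2 ^ ℓ : ℝ)⁻¹ *
    socialWelfare (copyVal (2 ^ ℓ) v) Finset.univ Finset.univ with hD
  have hs0 : 0 ≤ s 0 := mul_nonneg (by positivity) (Finset.sum_nonneg fun i _ =>
    sub_nonneg.mpr (socialWelfare_erase_le (copyVal_nonneg v) i _))
  have hstep : ∀ ℓ, D ℓ - D (ℓ + 1) ≤ s (ℓ + 1) := by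
    intro ℓ
    -- The type of the allocation contains `2 ^ (ℓ + 1)`; a variable `k` allows it to be replaced by
    -- `2 * 2 ^ ℓ`.
    have key : ∀ k, k = 2 * 2 ^ ℓ → ∀ A : Fin n → Finset (Copies m k),
        IsWelfareMaximizing (copyVal k v) A → IsNonRedundant (copyVal k v) A →
        2 * socialWelfare (copyVal (2 ^ ℓ) v) Finset.univ Finset.univ -
          socialWelfare (copyVal k v) Finset.univ Finset.univ ≤
        ∑ i, (socialWelfare (copyVal k v) Finset.univ Finset.univ -
          socialWelfare (copyVal k v) (Finset.univ.erase i) Finset.univ) := by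
      rintro k rfl A hA hA'
      exact two_mul_socialWelfare_sub_le hA hA'
    have h1 := key (2 ^ (ℓ + 1)) (pow_succ' 2 ℓ) _ (h (ℓ + 1) v).1 (h (ℓ + 1) v).2.1
    have h2 := mul_le_mul_of_nonneg_left h1 (show (0 : ℝ) ≤ (2 ^ (ℓ + 1))⁻¹ by positivity)
    refine le_trans (le_of_eq ?_) h2
    simp only [hD]
    rw [mul_sub, ← mul_assoc, show ((2 : ℝ) ^ (ℓ + 1))⁻¹ * 2 = (2 ^ ℓ)⁻¹ by
      rw [pow_succ, mul_inv, mul_assoc, inv_mul_cancel₀ two_ne_zero, mul_one]]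
  have := telescoping_le_sum hs0 hstep r
  rw [← Fin.sum_univ_eq_sum_range] at this
  refine le_trans (le_of_eq ?_) this
  simp [hD]

theorem sq_le_two_pow_logParam {n : ℕ} (hn : 0 < n) : (n : ℝ) ^ 2 ≤ 2 ^ logParam n := by
  have h0 : (0 : ℝ) < n := by exact_mod_cast hn
  calc (n : ℝ) ^ 2 = (2 : ℝ) ^ (Real.logb 2 ((n : ℝ) ^ 2)) :=
        (Real.rpow_logb (by norm_num) (by norm_num) (by positivity)).symm
    _ ≤ (2 : ℝ) ^ ((logParam n : ℕ) : ℝ) := by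
        refine Real.rpow_le_rpow_of_exponent_le (by norm_num) ?_
        rw [Real.logb_pow]
        exact_mod_cast Nat.le_ceil _
    _ = 2 ^ logParam n := Real.rpow_natCast _ _

theorem one_le_logb_two {n : ℕ} (hn : 2 ≤ n) : 1 ≤ Real.logb 2 n := by
  rw [Real.le_logb_iff_rpow_le (by norm_num) (by positivity), Real.rpow_one]
  exact_mod_cast hn

theorem logParam_add_one_le {n : ℕ} (hn : 2 ≤ n) : (logParam n : ℝ) + 1 ≤ 4 * Real.logb 2 n := by
  have h1 := one_le_logb_two hn
  have h2 : (logParam n : ℝ) < 2 * Real.logb 2 n + 1 := Nat.ceil_lt_add_one (by linarith)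
  linarith

/-- The constant is `16 = 2 * 2 * 4`: the coin toss, the tail of at most half the optimum, and
`logParam n + 1 ≤ 4 * Real.logb 2 n`. -/
theorem guaranteesApproximation_vcgWithCopies {n m : ℕ} (hn : 2 ≤ n) {alloc : AllocationRule n m}
    (h : IsVCGImplementation alloc) :
    (vcgWithCopies (logParam n) alloc (intervalRounding n m)).GuaranteesApproximation
      (16 * Real.logb 2 n) := by
  have hL := one_le_logb_two hn
  refine ⟨by linarith, fun v => ?_⟩
  set W := socialWelfare (fun i => (v i).1.val) Finset.univ Finset.univ with hW
  have hW0 : 0 ≤ W := by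
    refine le_trans ?_ (le_socialWelfare _ _ (A := fun _ => ∅)
      ⟨fun _ => Finset.empty_subset _, fun _ _ _ => Finset.disjoint_empty_left _⟩)
    exact Finset.sum_nonneg fun j _ => (v j).1.nonneg _
  have hn' : (2 : ℝ) ≤ n := by exact_mod_cast hn
  have hpow := sq_le_two_pow_logParam (show 0 < n by omega)
  have hsum := sub_le_sum_surplus h v (logParam n)
  have hone := socialWelfare_le_copyVal_one v
  have htail : ((2 : ℝ) ^ logParam n)⁻¹ *
      socialWelfare (copyVal (2 ^ logParam n) v) Finset.univ Finset.univ ≤ W / 2 := by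
    rw [inv_mul_le_iff₀ (by positivity)]
    refine (socialWelfare_copyVal_le_mul v).trans ?_
    -- `2 * n ≤ n ^ 2` because `n ≥ 2`.
    have h1 : 2 * (n : ℝ) ≤ 2 ^ logParam n := by nlinarith
    have h2 := mul_le_mul_of_nonneg_right h1 hW0
    linarith
  rw [expect_sum_utility h]
  simp only [mul_left_comm _ (2⁻¹ : ℝ)]
  rw [← Finset.mul_sum]
  have hr := logParam_add_one_le hn
  have hr0 : (0 : ℝ) < (logParam n : ℝ) + 1 := by positivity
  calc W / (16 * Real.logb 2 n) ≤ W / (4 * ((logParam n : ℝ) + 1)) :=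
        div_le_div_of_nonneg_left hW0 (by positivity) (by linarith)
    _ = ((logParam n : ℝ) + 1)⁻¹ * (2⁻¹ * (W / 2)) := by
        field_simp
        norm_num
    _ ≤ _ := by
        refine mul_le_mul_of_nonneg_left (mul_le_mul_of_nonneg_left ?_ (by norm_num))
          (by positivity)
        linarith

end ConsumerSurplus

theorem mainTheorem2 :
    (∀ n m : ℕ, ∃ alloc : ConsumerSurplus.AllocationRule n m,
      ConsumerSurplus.IsVCGImplementation alloc) ∧
    ∃ C : ℝ, ∀ (n m : ℕ) (alloc : ConsumerSurplus.AllocationRule n m),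
      ConsumerSurplus.IsVCGImplementation alloc →
      (ConsumerSurplus.vcgWithCopies (ConsumerSurplus.logParam n) alloc
        (ConsumerSurplus.intervalRounding n m)).IsFeasible ∧
      (ConsumerSurplus.vcgWithCopies (ConsumerSurplus.logParam n) alloc
        (ConsumerSurplus.intervalRounding n m)).IsTIE ∧
      (ConsumerSurplus.vcgWithCopies (ConsumerSurplus.logParam n) alloc
        (ConsumerSurplus.intervalRounding n m)).IsEPIR ∧
      (2 ≤ n →
        (ConsumerSurplus.vcgWithCopies (ConsumerSurplus.logParam n) alloc
          (ConsumerSurplus.intervalRounding n m)).GuaranteesApproximation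
            (C * Real.logb 2 n)) := by
  refine ⟨fun n m => ?_, 16, fun n m alloc h => ⟨ConsumerSurplus.isFeasible_vcgWithCopies _ h,
    ConsumerSurplus.isTIE_vcgWithCopies _ h, ConsumerSurplus.isEPIR_vcgWithCopies _ h,
    fun hn => ConsumerSurplus.guaranteesApproximation_vcgWithCopies hn h⟩⟩
  choose alloc halloc using fun (ℓ : ℕ) (v : Fin n → ConsumerSurplus.MUSValuation m) =>
    ConsumerSurplus.exists_vcg_allocation (2 ^ ℓ) v
  exact ⟨alloc, halloc⟩
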